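/- Let $P^{\otimes 6}=\mathbb F_2[t_1,\dots,t_6]$ with $\deg t_j=1$, let $P^{\otimes 6}_n$ be its subspace of homogeneous polynomials of degree $n$, and let the mod $2$ Steenrod algebra $\mathcal A$ act on $P^{\otimes 6}$ by the Cartan formula together with $Sq^0t_j=t_j$, $Sq^1t_j=t_j^2$ and $Sq^kt_j=0$ for $k>1$. Let $\overline{\mathcal A}$ be the set of elements of positive degree of $\mathcal A$, and put $QP^{\otimes 6}_n=P^{\otimes 6}_n/(P^{\otimes 6}_n\cap\overline{\mathcal A}P^{\otimes 6})$; write $[f]$ for the class of $f\in P^{\otimes 6}_n$ in $QP^{\otimes 6}_n$. For a monomial $t=t_1^{a_1}\cdots t_6^{a_6}$ let $a(t)=(a_1,\dots,a_6)$, and let $\omega(t)=(\omega_1(t),\omega_2(t),\dots)$, where $\omega_i(t)$ is the number of indices $j$ for which the coefficient of $2^{i-1}$ in the binary expansion of $a_j$ is $1$. For monomials $t,t'$ write $t<t'$ if $\omega(t)<\omega(t')$, or $\omega(t)=\omega(t')$ and $a(t)<a(t')$, both in the left lexicographical order. A monomial $t$ of degree $n$ is inadmissible if $t=\sum_{j=1}^k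 z_j+\sum_{0<m<n}Sq^m(f_m)$ for some $k\ge 0$, some monomials $z_j<t$ of degree $n$ and some $f_m\in P^{\otimes 6}_{n-m}$; otherwise $t$ is admissible. Let $\mathscr C^{\otimes 6}_n$ be the set of admissible monomials of degree $n$. For $s\ge 0$ put $n_s=6(2^s-1)+10\cdot 2^s$ (so $n_1=26$), and let $\psi:P^{\otimes 6}\to P^{\otimes 6}$, $\psi(t)=t_1t_2\cdots t_6\,t^2$. Then for every integer $s\ge 2$, $$\psi^{s-1}(\mathscr C^{\otimes 6}_{n_1})=\Big\{\prod_{1\le j\le 6}t_j^{2^{s-1}-1}\,u^{2^{s-1}}:\ u\in\mathscr C^{\otimes 6}_{n_1}\Big\},$$ every element of this set is a monomial of degree $n_s$, and the classes $[t]$, $t\in\psi^{s-1}(\mathscr C^{\otimes 6}_{n_1})$, are pairwise distinct and form a basis of the $\mathbb F_2$-vector space $QP^{\otimes 6}_{n_s}$. -/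

import Mathlib

/-!
The hit problem for the polynomial algebra `𝔽₂[t₁, …, t_h]` as a module over the mod 2 Steenrod
algebra.
-/

namespace HitProblem

open MvPolynomial

/-- The polynomial algebra `P^{⊗h} = 𝔽₂[t₁, …, t_h]`, with `deg t_j = 1`. -/
abbrev P (h : ℕ) : Type := MvPolynomial (Fin h) (ZMod 2)

/-- The subspace `P_n^{⊗h}` of homogeneous polynomials of degree `n`. -/
abbrev Pdeg (h n : ℕ) : Submodule (ZMod 2) (P h) := homogeneousSubmodule (Fin h) (ZMod 2) n

/-- The total Steenrod square `f ↦ ∑ₖ Sqᵏ(f) xᵏ`. It is the ring homomorphism (this is the Cartan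
formula) with `t_j ↦ t_j + t_j² x`, that is `Sq⁰ t_j = t_j`, `Sq¹ t_j = t_j²` and `Sqᵏ t_j = 0`
for `k > 1`. -/
noncomputable def totalSq (h : ℕ) : P h →ₐ[ZMod 2] Polynomial (P h) :=
  aeval fun j : Fin h =>
    Polynomial.C (X j : P h) + Polynomial.C ((X j : P h) ^ 2) * Polynomial.X

/-- The Steenrod square `Sqᵏ` acting on `P^{⊗h}`. -/
noncomputable def Sq (h k : ℕ) : Module.End (ZMod 2) (P h) :=
  ((Polynomial.lcoeff (P h) k).restrictScalars (ZMod 2)).comp (totalSq h).toLinearMap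

/-- The operators on `P^{⊗h}` given by the elements of positive degree of the Steenrod algebra:
the Steenrod algebra is generated by the squares, so these are the sums of nonempty composites of
squares `Sqᵏ` with `k > 0`. -/
noncomputable def positiveOps (h : ℕ) :
    NonUnitalSubalgebra (ZMod 2) (Module.End (ZMod 2) (P h)) :=
  NonUnitalAlgebra.adjoin (ZMod 2) {θ | ∃ k : ℕ, 0 < k ∧ θ = Sq h k}

/-- The subspace of hit polynomials: the span of all `θ(f)`, where `θ` is an element of positive
degree of the Steenrod algebra and `f` is a polynomial. -/
noncomputable def hit (h : ℕ) : Submodule (ZMod 2) (P h) :=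
  Submodule.span (ZMod 2) {g | ∃ θ ∈ positiveOps h, ∃ f : P h, g = θ f}

/-- The cohit space `QP_n^{⊗h} = P_n^{⊗h} / (P_n^{⊗h} ∩ hit)`. -/
abbrev QP (h n : ℕ) : Type := ↥(Pdeg h n) ⧸ (hit h).submoduleOf (Pdeg h n)

/-- The class `[f]` in `QP_n^{⊗h}` of a homogeneous polynomial `f` of degree `n`. -/
noncomputable def cls {h n : ℕ} (f : ↥(Pdeg h n)) : QP h n := Submodule.Quotient.mk f

/-- The monomial `t₁^{a₁} ⋯ t_h^{a_h}` with exponent vector `a`. -/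
noncomputable def mon {h : ℕ} (a : Fin h →₀ ℕ) : P h := monomial a 1

/-- The weight vector of the monomial with exponent vector `a`; the entry at `i` (starting from
`i = 0`) is the number of `j` for which the digit of `2^i` in the binary expansion of `a_j`
is `1`. -/
def weight {h : ℕ} (a : Fin h →₀ ℕ) (i : ℕ) : ℕ := ∑ j : Fin h, ((a j).testBit i).toNat

/-- The linear order on monomials, written on exponent vectors: compare weight vectors in the left
lexicographical order, and then exponent vectors in the left lexicographical order. -/
def MonLT {h : ℕ} (a b : Fin h →₀ ℕ) : Prop :=
  toLex (weight a) < toLex (weight b) ∨ (weight a = weight b ∧ toLex (⇑a) < toLex (⇑b))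

/-- The monomial `t` of degree `n` with exponent vector `a` is inadmissible if
`t = ∑ z_j + ∑_{0 < m < n} Sq^m(f_m)`, with monomials `z_j < t` of degree `n` and homogeneous
polynomials `f_m` of degree `n - m`. -/
def Inadmissible {h : ℕ} (n : ℕ) (a : Fin h →₀ ℕ) : Prop :=
  ∃ (Z : Finset (Fin h →₀ ℕ)) (f : ℕ → P h),
    (∀ z ∈ Z, z.degree = n ∧ MonLT z a) ∧
    (∀ m ∈ Finset.Ioo 0 n, f m ∈ Pdeg h (n - m)) ∧
    mon a = ∑ z ∈ Z, mon z + ∑ m ∈ Finset.Ioo 0 n, Sq h m (f m)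

/-- The set `𝒞_n^{⊗h}` of all admissible monomials of degree `n`. -/
def admissibleMonomials (h n : ℕ) : Set (P h) :=
  {t | ∃ a : Fin h →₀ ℕ, a.degree = n ∧ ¬ Inadmissible n a ∧ t = mon a}

/-- The up Kameko map `ψ(t) = t₁ ⋯ t_h t²`. -/
noncomputable def upKameko (h : ℕ) (t : P h) : P h := (∏ j : Fin h, X j) * t ^ 2

/-- The classes of the members of `S` form a monomial basis of `QP_n^{⊗h}`: every member of `S` is
a monomial of degree `n`, and the classes `[t]`, `t ∈ S`, are linearly independent (in particular
pairwise distinct) and span. -/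
def IsMonomialBasis (h n : ℕ) (S : Set (P h)) : Prop :=
  (∀ t ∈ S, ∃ a : Fin h →₀ ℕ, t = mon a) ∧
  ∃ hS : ∀ t ∈ S, t ∈ Pdeg h n,
    LinearIndependent (ZMod 2) (fun t : ↥S => (cls ⟨t.1, hS t.1 t.2⟩ : QP h n)) ∧
    Submodule.span (ZMod 2) (Set.range fun t : ↥S => (cls ⟨t.1, hS t.1 t.2⟩ : QP h n)) = ⊤

/-- The degree `n_s = 6(2^s - 1) + 10 · 2^s`. -/
def genericDegree (s : ℕ) : ℕ := 6 * (2 ^ s - 1) + 10 * 2 ^ s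

end HitProblem

namespace HitProblem

open MvPolynomial

variable {h : ℕ}

/-! In every degree the admissible monomials form a basis of the cohits
(`isBasisModHit_admissibleMonomials`), so it suffices that `upKameko` carries a monomial basis in
degree `n_s` to one in degree `n_{s+1} = 2 n_s + 6` for every `s ≥ 1`.

The squares are handled all at once by the ring endomorphism `sqSum`, `X j ↦ X j + X j ^ 2`: a form
of degree `n` is hit iff it is the degree `n` part of `sqSum f` for some `f` with no degree `n` part
(`mem_hit_iff`). The down Kameko map commutes with `sqSum`, hence preserves hits. It is a left
inverse of the up map, so independence lifts. The up map need not preserve hits, but it does so, and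
is onto modulo hits, once every monomial with an even exponent is hit in the target degree.

That last condition is arithmetic. A telescoping product shows that a monomial of degree `r + 2m`
with `r` odd exponents is hit unless `r + m` is a sum of `r` powers of two
(`mon_mem_hit_of_forall_ne`). Since `n_s + 6` is a power of two, for `s ≥ 2` and `r < 6` the binary
digit sum of `r + m` exceeds `r`. -/

/-! ### Monomials and homogeneous components -/

lemma mon_add (a b : Fin h →₀ ℕ) : mon (a + b) = mon a * mon b := by
  simp [mon, monomial_mul]

lemma mon_zero : mon (0 : Fin h →₀ ℕ) = 1 := rfl

lemma mon_single (j : Fin h) (n : ℕ) : mon (Finsupp.single j n) = (X j : P h) ^ n := by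
  simp [mon, X_pow_eq_monomial]

lemma mon_injective : Function.Injective (mon : (Fin h →₀ ℕ) → P h) :=
  monomial_left_injective one_ne_zero

lemma mon_mem_Pdeg (a : Fin h →₀ ℕ) : mon a ∈ Pdeg h a.degree :=
  isHomogeneous_monomial 1 rfl

/-- An element of `P h` is the sum of the monomials in its support. -/
lemma eq_sum_mon (f : P h) : f = ∑ a ∈ f.support, mon a := by
  conv_lhs => rw [f.as_sum]
  refine Finset.sum_congr rfl fun a ha => ?_
  have : coeff a f = 1 := by
    have := mem_support_iff.1 ha
    generalize coeff a f = c at *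
    revert c
    decide
  rw [this, mon]

lemma mon_induction {p : P h → Prop} (h0 : p 0) (hmon : ∀ a, p (mon a))
    (hadd : ∀ f g, p f → p g → p (f + g)) (f : P h) : p f := by
  rw [eq_sum_mon f]
  exact Finset.sum_induction _ p hadd h0 fun a _ => hmon a

lemma add_self_eq_zero (f : P h) : f + f = 0 := CharTwo.add_self_eq_zero f

lemma comp_mon (n : ℕ) (a : Fin h →₀ ℕ) :
    homogeneousComponent n (mon a) = if a.degree = n then mon a else 0 := by
  rw [homogeneousComponent_of_mem (mon_mem_Pdeg a)]
  simp only [eq_comm]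

lemma comp_mon_mul (a : Fin h →₀ ℕ) (k : ℕ) (g : P h) :
    homogeneousComponent (a.degree + k) (mon a * g) = mon a * homogeneousComponent k g := by
  induction g using mon_induction with
  | h0 => simp
  | hmon b =>
    rw [← mon_add, comp_mon, comp_mon]
    simp [map_add, mon_add]
  | hadd f g hf hg => rw [mul_add, map_add, map_add, hf, hg, mul_add]

lemma comp_mon_mul_eq_zero {a : Fin h →₀ ℕ} {n : ℕ} (ha : n < a.degree) (g : P h) :
    homogeneousComponent n (mon a * g) = 0 := by
  induction g using mon_induction with
  | h0 => simp
  | hmon b =>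
    rw [← mon_add, comp_mon, if_neg]
    simp only [map_add]
    omega
  | hadd f g hf hg => rw [mul_add, map_add, hf, hg, add_zero]

/-! ### The total square at `x = 1` -/

/-- The total square `f ↦ ∑ₖ Sqᵏ(f)`. -/
noncomputable def sqSum (h : ℕ) : P h →ₐ[ZMod 2] P h := aeval fun j => X j + X j ^ 2

lemma sqSum_eq_eval (f : P h) : sqSum h f = (totalSq h f).eval 1 := by
  have : sqSum h =
      ((Polynomial.aeval (1 : P h)).restrictScalars (ZMod 2)).comp (totalSq h) := by
    refine MvPolynomial.algHom_ext fun j => ?_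
    simp [sqSum, totalSq]
  rw [this]
  simp [Polynomial.coe_aeval_eq_eval]

lemma Sq_apply (k : ℕ) (f : P h) : Sq h k f = (totalSq h f).coeff k := rfl

lemma Sq_mon_mem (a : Fin h →₀ ℕ) (k : ℕ) : Sq h k (mon a) ∈ Pdeg h (a.degree + k) := by
  simp only [Sq_apply]
  have hmul : ∀ a b : Fin h →₀ ℕ,
      (∀ k, (totalSq h (mon a)).coeff k ∈ Pdeg h (a.degree + k)) →
      (∀ k, (totalSq h (mon b)).coeff k ∈ Pdeg h (b.degree + k)) →
      ∀ k, (totalSq h (mon (a + b))).coeff k ∈ Pdeg h ((a + b).degree + k) := by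
    intro a b ha hb k
    rw [mon_add, map_mul, Polynomial.coeff_mul]
    refine Submodule.sum_mem _ fun x hx => ?_
    have := IsHomogeneous.mul (ha x.1) (hb x.2)
    rw [Finset.HasAntidiagonal.mem_antidiagonal] at hx
    rw [mem_homogeneousSubmodule]
    convert this using 1
    rw [map_add]
    omega
  have hzero : ∀ k, (totalSq h (mon 0)).coeff k ∈ Pdeg h ((0 : Fin h →₀ ℕ).degree + k) := by
    intro k
    rw [mon_zero, map_one, Polynomial.coeff_one]
    split_ifs with hk
    · subst hk
      rw [map_zero]
      exact isHomogeneous_one (Fin h) (ZMod 2)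
    · exact Submodule.zero_mem _
  revert k
  induction a using Finsupp.induction_linear with
  | zero => exact hzero
  | add a b ha hb => exact hmul a b ha hb
  | single j n =>
    induction n with
    | zero => simpa using hzero
    | succ n ih =>
      rw [Finsupp.single_add]
      refine hmul _ _ ih fun k => ?_
      rw [mon_single, pow_one, Finsupp.degree_single]
      have : totalSq h (X j : P h) =
          Polynomial.C (X j : P h) + Polynomial.C ((X j : P h) ^ 2) * Polynomial.X := by
        simp [totalSq]
      rw [this, Polynomial.coeff_add, Polynomial.coeff_C_mul, Polynomial.coeff_C,
        Polynomial.coeff_X]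
      rcases k with _ | _ | k
      · simpa using isHomogeneous_X (ZMod 2) j
      · simpa using isHomogeneous_X_pow (R := ZMod 2) j 2
      · simp

lemma comp_Sq (n k : ℕ) (f : P h) :
    homogeneousComponent n (Sq h k f) =
      if k ≤ n then Sq h k (homogeneousComponent (n - k) f) else 0 := by
  induction f using mon_induction with
  | h0 => simp
  | hmon a =>
    rw [homogeneousComponent_of_mem (Sq_mon_mem a k), comp_mon]
    split_ifs <;> first | rfl | omega
  | hadd f g hf hg =>
    simp only [map_add, hf, hg]
    split_ifs <;> simp

lemma comp_sqSum (n : ℕ) (f : P h) :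
    homogeneousComponent n (sqSum h f) =
      ∑ k ∈ Finset.range (n + 1), Sq h k (homogeneousComponent (n - k) f) := by
  have hN : (totalSq h f).natDegree < max ((totalSq h f).natDegree + 1) (n + 1) :=
    lt_of_lt_of_le (Nat.lt_succ_self _) (le_max_left _ _)
  rw [sqSum_eq_eval, Polynomial.eval_eq_sum_range' hN, map_sum]
  simp only [one_pow, mul_one, ← Sq_apply, comp_Sq]
  rw [← Finset.sum_filter]
  refine Finset.sum_congr ?_ fun _ _ => rfl
  ext k
  simp only [Finset.mem_filter, Finset.mem_range]
  omega

lemma Sq_one_of_pos {k : ℕ} (hk : 0 < k) : Sq h k 1 = 0 := by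
  rw [Sq_apply, map_one, Polynomial.coeff_one, if_neg hk.ne']

lemma Sq_comp_zero {k : ℕ} (hk : 0 < k) (f : P h) : Sq h k (homogeneousComponent 0 f) = 0 := by
  induction f using mon_induction with
  | h0 => simp
  | hmon a =>
    rw [comp_mon]
    split_ifs with ha
    · rw [(Finsupp.degree_eq_zero_iff a).1 ha, mon_zero, Sq_one_of_pos hk]
    · simp
  | hadd f g hf hg => rw [map_add, map_add, hf, hg, add_zero]

/-- If `f` has no part of degree `n`, the degree `n` part of the total square of `f` only
involves `Sqᵏ` with `0 < k < n`. -/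
lemma comp_sqSum_of_comp_eq_zero {n : ℕ} {f : P h} (hf : homogeneousComponent n f = 0) :
    homogeneousComponent n (sqSum h f) =
      ∑ k ∈ Finset.Ioo 0 n, Sq h k (homogeneousComponent (n - k) f) := by
  rw [comp_sqSum]
  symm
  refine Finset.sum_subset (fun k => by simp; omega) fun k hk hk' => ?_
  simp only [Finset.mem_range, Finset.mem_Ioo] at hk hk'
  rcases Nat.eq_zero_or_pos k with rfl | hk0
  · simp [hf]
  · obtain rfl : k = n := by omega
    rw [Nat.sub_self, Sq_comp_zero hk0]

/-! ### Hit polynomials -/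

lemma hit_eq_span : hit h =
    Submodule.span (ZMod 2) {g | ∃ k : ℕ, 0 < k ∧ ∃ f : P h, g = Sq h k f} := by
  apply le_antisymm
  · refine Submodule.span_le.2 ?_
    rintro _ ⟨θ, hθ, f, rfl⟩
    revert f
    refine NonUnitalAlgebra.adjoin_induction (p := fun θ _ => ∀ f : P h, θ f ∈
      Submodule.span (ZMod 2) {g | ∃ k : ℕ, 0 < k ∧ ∃ f : P h, g = Sq h k f})
      ?_ ?_ ?_ ?_ ?_ hθ
    · rintro _ ⟨k, hk, rfl⟩ f
      exact Submodule.subset_span ⟨k, hk, f, rfl⟩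
    · intro θ η _ _ hθ hη f
      exact Submodule.add_mem _ (hθ f) (hη f)
    · intro f
      exact Submodule.zero_mem _
    · intro θ η _ _ hθ _ f
      exact hθ (η f)
    · intro c θ _ hθ f
      exact Submodule.smul_mem _ c (hθ f)
  · refine Submodule.span_mono ?_
    rintro _ ⟨k, hk, f, rfl⟩
    exact ⟨Sq h k, NonUnitalAlgebra.subset_adjoin _ ⟨k, hk, rfl⟩, f, rfl⟩

lemma Sq_mem_hit {k : ℕ} (hk : 0 < k) (f : P h) : Sq h k f ∈ hit h := by
  rw [hit_eq_span]
  exact Submodule.subset_span ⟨k, hk, f, rfl⟩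

lemma comp_sqSum_mem_hit {n : ℕ} {f : P h} (hf : homogeneousComponent n f = 0) :
    homogeneousComponent n (sqSum h f) ∈ hit h := by
  rw [comp_sqSum_of_comp_eq_zero hf]
  exact Submodule.sum_mem _ fun k hk => Sq_mem_hit (Finset.mem_Ioo.1 hk).1 _

/-- For a generator `Sq h k f` the component of `f` in degree `n - k` is a witness: in degree `n`
only `Sq h k` contributes, and `k > 0` keeps the witness out of degree `n`. The condition is
additive, so it passes to the span. -/
lemma exists_comp_sqSum_of_mem_hit {g : P h} (hg : g ∈ hit h) (n : ℕ) :
    ∃ f : P h, homogeneousComponent n f = 0 ∧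
      homogeneousComponent n g = homogeneousComponent n (sqSum h f) := by
  rw [hit_eq_span] at hg
  induction hg using Submodule.span_induction with
  | mem g hg =>
    obtain ⟨k, hk, f, rfl⟩ := hg
    rw [comp_Sq]
    split_ifs with hkn
    · have hc : ∀ m, homogeneousComponent m (homogeneousComponent (n - k) f) =
          if m = n - k then homogeneousComponent (n - k) f else 0 := fun m =>
        homogeneousComponent_of_mem (homogeneousComponent_mem _ _)
      refine ⟨homogeneousComponent (n - k) f, ?_, ?_⟩
      · rw [hc, if_neg (by omega)]
      · rw [comp_sqSum, Finset.sum_eq_single k]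
        · rw [hc, if_pos rfl]
        · intro m hm hmk
          rw [Finset.mem_range] at hm
          rw [hc, if_neg (by omega), map_zero]
        · intro hk'
          exact absurd (Finset.mem_range.2 (by omega)) hk'
    · exact ⟨0, by simp, by simp⟩
  | zero => exact ⟨0, by simp, by simp⟩
  | add g g' _ _ hg hg' =>
    obtain ⟨f, hf, hgf⟩ := hg
    obtain ⟨f', hf', hgf'⟩ := hg'
    exact ⟨f + f', by rw [map_add, hf, hf', add_zero], by simp only [map_add, hgf, hgf']⟩
  | smul c g _ hg =>
    obtain ⟨f, hf, hgf⟩ := hg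
    exact ⟨c • f, by rw [map_smul, hf, smul_zero], by simp only [map_smul, hgf]⟩

/-- A polynomial of degree `n` is hit if and only if it is the degree `n` part of the total square
of a polynomial without degree `n` part. -/
lemma mem_hit_iff {n : ℕ} {g : P h} (hg : g ∈ Pdeg h n) :
    g ∈ hit h ↔ ∃ f : P h, homogeneousComponent n f = 0 ∧
      g = homogeneousComponent n (sqSum h f) := by
  constructor
  · intro hh
    obtain ⟨f, hf, hgf⟩ := exists_comp_sqSum_of_mem_hit hh n
    exact ⟨f, hf, by rw [← hgf, homogeneousComponent_eq_self hg]⟩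
  · rintro ⟨f, hf, rfl⟩
    exact comp_sqSum_mem_hit hf

/-! ### The Kameko maps -/

lemma sqSum_mon (a : Fin h →₀ ℕ) : sqSum h (mon a) = ∏ j, (X j + X j ^ 2 : P h) ^ a j := by
  rw [sqSum, mon, aeval_monomial, map_one, one_mul, Finsupp.prod_fintype _ _ (by simp)]

lemma mon_eq_prod (a : Fin h →₀ ℕ) : mon a = ∏ j, (X j : P h) ^ a j := by
  rw [mon, monomial_eq, map_one, one_mul, Finsupp.prod_fintype _ _ (by simp)]

/-- The exponent vector with entries `1` on `J` and `0` elsewhere. -/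
noncomputable def indicatorExp (J : Finset (Fin h)) : Fin h →₀ ℕ :=
  Finsupp.equivFunOnFinite.symm fun j => if j ∈ J then 1 else 0

/-- Halving all exponents, rounding down. -/
noncomputable def halfExp (a : Fin h →₀ ℕ) : Fin h →₀ ℕ :=
  Finsupp.equivFunOnFinite.symm fun j => a j / 2

/-- The set of variables with odd exponent. -/
def oddVars (a : Fin h →₀ ℕ) : Finset (Fin h) := Finset.univ.filter fun j => a j % 2 = 1

@[simp] lemma indicatorExp_apply (J : Finset (Fin h)) (j : Fin h) :
    indicatorExp J j = if j ∈ J then 1 else 0 := rfl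

@[simp] lemma halfExp_apply (a : Fin h →₀ ℕ) (j : Fin h) : halfExp a j = a j / 2 := rfl

@[simp] lemma mem_oddVars {a : Fin h →₀ ℕ} {j : Fin h} : j ∈ oddVars a ↔ a j % 2 = 1 := by
  simp [oddVars]

lemma exp_eq (a : Fin h →₀ ℕ) : a = indicatorExp (oddVars a) + 2 • halfExp a := by
  ext j
  simp only [Finsupp.add_apply, Finsupp.smul_apply, indicatorExp_apply, halfExp_apply,
    mem_oddVars, smul_eq_mul]
  split_ifs <;> omega

lemma mon_two_smul (a : Fin h →₀ ℕ) : mon (2 • a) = mon a ^ 2 := by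
  rw [two_smul, mon_add, sq]

lemma mon_indicatorExp (J : Finset (Fin h)) : mon (indicatorExp J) = ∏ j ∈ J, (X j : P h) := by
  rw [mon_eq_prod]
  simp only [indicatorExp_apply, pow_ite, pow_one, pow_zero]
  rw [Finset.prod_ite_mem, Finset.univ_inter]

lemma degree_indicatorExp (J : Finset (Fin h)) : (indicatorExp J).degree = J.card := by
  rw [Finsupp.degree_eq_sum]
  simp

lemma mon_eq (a : Fin h →₀ ℕ) : mon a = (∏ j ∈ oddVars a, X j) * mon (halfExp a) ^ 2 := by
  conv_lhs => rw [exp_eq a]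
  rw [mon_add, mon_two_smul, mon_indicatorExp]

/-- The down Kameko map, the left inverse of the up Kameko map that vanishes on the monomials
with an even exponent. -/
noncomputable def downKameko (h : ℕ) : P h →ₗ[ZMod 2] P h :=
  (basisMonomials (Fin h) (ZMod 2)).constr (ZMod 2) fun a =>
    if oddVars a = Finset.univ then mon (halfExp a) else 0

lemma downKameko_mon (a : Fin h →₀ ℕ) :
    downKameko h (mon a) = if oddVars a = Finset.univ then mon (halfExp a) else 0 := by
  have : mon a = basisMonomials (Fin h) (ZMod 2) a := by simp [mon]
  rw [this, downKameko, Module.Basis.constr_basis]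

/-- Multiplying by a square leaves the parities of the exponents unchanged; this semilinearity
reduces questions about `downKameko` to squarefree monomials. -/
lemma downKameko_mul_sq (f g : P h) : downKameko h (f * g ^ 2) = downKameko h f * g := by
  induction g using mon_induction with
  | h0 => simp
  | hmon b =>
    induction f using mon_induction with
    | h0 => simp
    | hmon a =>
      have h1 : oddVars (a + 2 • b) = oddVars a := by
        ext j
        simp
      have h2 : halfExp (a + 2 • b) = halfExp a + b := by
        ext j
        simp
        omega
      rw [← mon_two_smul, ← mon_add, downKameko_mon, downKameko_mon, h1, h2]
      split_ifs
      · rw [mon_add]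
      · rw [zero_mul]
    | hadd f g hf hg => rw [add_mul, map_add, map_add, hf, hg, add_mul]
  | hadd g g' hg hg' => rw [CharTwo.add_sq, mul_add, map_add, hg, hg', mul_add]

lemma downKameko_prod (J : Finset (Fin h)) :
    downKameko h (∏ j ∈ J, X j) = if J = Finset.univ then 1 else 0 := by
  have h1 : oddVars (indicatorExp J) = J := by
    ext j
    simp only [mem_oddVars, indicatorExp_apply]
    split_ifs <;> simp_all
  have h2 : halfExp (indicatorExp J) = 0 := by
    ext j
    simp only [halfExp_apply, indicatorExp_apply]
    split_ifs <;> simp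
  rw [← mon_indicatorExp, downKameko_mon, h1, h2, mon_zero]

lemma upKameko_eq (t : P h) : upKameko h t = (∏ j, X j) * t ^ 2 := rfl

lemma downKameko_upKameko (f : P h) : downKameko h (upKameko h f) = f := by
  rw [upKameko_eq, downKameko_mul_sq, downKameko_prod, if_pos rfl, one_mul]

lemma upKameko_injective : Function.Injective (upKameko h) :=
  Function.LeftInverse.injective downKameko_upKameko

lemma upKameko_add (f g : P h) : upKameko h (f + g) = upKameko h f + upKameko h g := by
  simp only [upKameko_eq, CharTwo.add_sq, mul_add]

lemma upKameko_zero : upKameko h 0 = 0 := by simp [upKameko_eq]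

/-- The up Kameko map as an additive map. -/
noncomputable def upKamekoHom (h : ℕ) : P h →+ P h where
  toFun := upKameko h
  map_zero' := upKameko_zero
  map_add' := upKameko_add

lemma upKameko_sum {ι : Type*} (T : Finset ι) (f : ι → P h) :
    upKameko h (∑ i ∈ T, f i) = ∑ i ∈ T, upKameko h (f i) :=
  map_sum (upKamekoHom h) f T

lemma upKameko_mon (a : Fin h →₀ ℕ) :
    upKameko h (mon a) = mon (indicatorExp Finset.univ + 2 • a) := by
  rw [mon_add, mon_two_smul, mon_indicatorExp, upKameko_eq]

/-- By semilinearity over squares only `∏ j ∈ J, X j` matters. Its total square is the sum over `K ⊆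
J` of `∏ X` over `K` times the square of `∏ X` over `J \ K`, and the down map kills every term
except `K = univ`, which occurs only for `J = univ`. -/
lemma downKameko_sqSum (f : P h) : downKameko h (sqSum h f) = sqSum h (downKameko h f) := by
  induction f using mon_induction with
  | h0 => simp
  | hmon a =>
    rw [mon_eq a, map_mul, map_pow, downKameko_mul_sq, downKameko_mul_sq, map_mul]
    congr 1
    generalize oddVars a = J
    rw [downKameko_prod, map_prod]
    have : ∀ j, sqSum h (X j : P h) = X j + X j ^ 2 := fun j => by simp [sqSum]
    simp only [this]
    rw [Finset.prod_add, map_sum]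
    simp only [Finset.prod_pow, downKameko_mul_sq, downKameko_prod]
    split_ifs with hJ
    · subst hJ
      rw [map_one, Finset.sum_eq_single Finset.univ]
      · simp
      · intro K _ hK
        rw [if_neg hK, zero_mul]
      · simp
    · rw [map_zero]
      refine Finset.sum_eq_zero fun K hK => ?_
      rw [if_neg, zero_mul]
      rintro rfl
      exact hJ (Finset.univ_subset_iff.1 (Finset.mem_powerset.1 hK))
  | hadd f g hf hg => simp only [map_add, hf, hg]

lemma degree_upExp (a : Fin h →₀ ℕ) :
    (indicatorExp Finset.univ + 2 • a).degree = 2 * a.degree + h := by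
  rw [map_add, map_nsmul, degree_indicatorExp, Finset.card_univ, Fintype.card_fin, smul_eq_mul,
    add_comm]

lemma comp_downKameko (m : ℕ) (f : P h) :
    homogeneousComponent m (downKameko h f) = downKameko h (homogeneousComponent (2 * m + h) f) := by
  induction f using mon_induction with
  | h0 => simp
  | hmon a =>
    rw [comp_mon, downKameko_mon]
    split_ifs with ha hd hd
    · rw [comp_mon, downKameko_mon, if_pos ha, if_pos]
      conv at hd => lhs; rw [exp_eq a, ha, degree_upExp]
      omega
    · rw [comp_mon, if_neg, map_zero]
      contrapose! hd
      conv => lhs; rw [exp_eq a, ha, degree_upExp]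
      omega
    · rw [map_zero, downKameko_mon, if_neg ha]
    · simp
  | hadd f g hf hg => simp only [map_add, hf, hg]

lemma comp_upKameko (m : ℕ) (f : P h) :
    homogeneousComponent (2 * m + h) (upKameko h f) = upKameko h (homogeneousComponent m f) := by
  induction f using mon_induction with
  | h0 => simp [upKameko_zero]
  | hmon a =>
    rw [comp_mon, upKameko_mon, comp_mon, degree_upExp]
    split_ifs with h1 h2 h2
    · rw [upKameko_mon]
    · omega
    · omega
    · rw [upKameko_zero]
  | hadd f g hf hg => simp only [map_add, upKameko_add, hf, hg]

lemma upKameko_mem_Pdeg {m : ℕ} {f : P h} (hf : f ∈ Pdeg h m) :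
    upKameko h f ∈ Pdeg h (2 * m + h) := by
  rw [← homogeneousComponent_eq_self hf, ← comp_upKameko]
  exact homogeneousComponent_mem _ _

lemma downKameko_mem_Pdeg {m : ℕ} {f : P h} (hf : f ∈ Pdeg h (2 * m + h)) :
    downKameko h f ∈ Pdeg h m := by
  rw [← homogeneousComponent_eq_self hf, ← comp_downKameko]
  exact homogeneousComponent_mem _ _

/-- The down Kameko map sends hit polynomials to hit polynomials. -/
lemma downKameko_mem_hit {m : ℕ} {g : P h} (hg : g ∈ Pdeg h (2 * m + h)) (hh : g ∈ hit h) :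
    downKameko h g ∈ hit h := by
  obtain ⟨f, hf, rfl⟩ := (mem_hit_iff hg).1 hh
  rw [← comp_downKameko, downKameko_sqSum]
  exact comp_sqSum_mem_hit (by rw [comp_downKameko, hf, map_zero])

/-- If all monomials of degree `2m + h` with an even exponent are hit, then so are all polynomials
of that degree in the kernel of the down Kameko map. -/
lemma mem_hit_of_downKameko_eq_zero {m : ℕ}
    (hW : ∀ a : Fin h →₀ ℕ, a.degree = 2 * m + h → oddVars a ≠ Finset.univ → mon a ∈ hit h)
    {g : P h} (hg : g ∈ Pdeg h (2 * m + h)) (hg0 : downKameko h g = 0) : g ∈ hit h := by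
  -- The composite up after down fixes monomials with all exponents odd and kills the others, which
  -- are hit by `hW`.
  have key : ∀ f : P h, homogeneousComponent (2 * m + h) f +
      upKameko h (downKameko h (homogeneousComponent (2 * m + h) f)) ∈ hit h := by
    intro f
    induction f using mon_induction with
    | h0 => simp [upKameko_zero]
    | hmon a =>
      rw [comp_mon]
      split_ifs with hd
      · rw [downKameko_mon]
        split_ifs with ha
        · have : upKameko h (mon (halfExp a)) = mon a := by
            conv_rhs => rw [exp_eq a, ha]
            rw [upKameko_mon]
          rw [this, add_self_eq_zero]
          exact Submodule.zero_mem _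
        · rw [upKameko_zero, add_zero]
          exact hW a hd ha
      · simp [upKameko_zero]
    | hadd f g hf hg =>
      simp only [map_add, upKameko_add]
      rw [add_add_add_comm]
      exact Submodule.add_mem _ hf hg
  have := key g
  rwa [homogeneousComponent_eq_self hg, hg0, upKameko_zero, add_zero] at this

/-- In the same situation the up Kameko map sends hit polynomials to hit polynomials. -/
lemma upKameko_mem_hit {m : ℕ}
    (hW : ∀ a : Fin h →₀ ℕ, a.degree = 2 * m + h → oddVars a ≠ Finset.univ → mon a ∈ hit h)
    {g : P h} (hg : g ∈ Pdeg h m) (hh : g ∈ hit h) : upKameko h g ∈ hit h := by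
  obtain ⟨f, hf, hgf⟩ := (mem_hit_iff hg).1 hh
  have h1 : homogeneousComponent (2 * m + h) (sqSum h (upKameko h f)) ∈ hit h :=
    comp_sqSum_mem_hit (by rw [comp_upKameko, hf, upKameko_zero])
  -- Both summands have the same image `g` under the down map, so their sum lies in its kernel.
  have h2 : upKameko h g + homogeneousComponent (2 * m + h) (sqSum h (upKameko h f)) ∈ hit h := by
    refine mem_hit_of_downKameko_eq_zero hW
      (Submodule.add_mem _ (upKameko_mem_Pdeg hg) (homogeneousComponent_mem _ _)) ?_
    rw [map_add, downKameko_upKameko, ← comp_downKameko, downKameko_sqSum, downKameko_upKameko,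
      ← hgf, add_self_eq_zero]
  have := Submodule.add_mem _ h2 h1
  rwa [add_assoc, add_self_eq_zero, add_zero] at this

/-! ### Monomials that are hit for reasons of degree -/

/-- By Legendre's formula the digit sum of `n` is `n` minus the 2-adic valuation of `n!`, and `a!
b!` divides `(a + b)!`. -/
lemma digits_sum_add_le (a b : ℕ) :
    (Nat.digits 2 (a + b)).sum ≤ (Nat.digits 2 a).sum + (Nat.digits 2 b).sum := by
  have hle : ∀ n : ℕ, (Nat.digits 2 n).sum ≤ n := fun n => Nat.digit_sum_le 2 n
  have hv : padicValNat 2 a.factorial + padicValNat 2 b.factorial ≤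
      padicValNat 2 (a + b).factorial := by
    rw [← padicValNat.mul a.factorial_ne_zero b.factorial_ne_zero]
    exact (padicValNat_dvd_iff_le (a + b).factorial_ne_zero).1
      (pow_padicValNat_dvd.trans (Nat.factorial_mul_factorial_dvd_factorial_add a b))
  have key := fun n => sub_one_mul_padicValNat_factorial (p := 2) n
  have ha := key a
  have hb := key b
  have hab := key (a + b)
  have := hle a
  have := hle b
  have := hle (a + b)
  omega

lemma digits_sum_two_pow (k : ℕ) : (Nat.digits 2 (2 ^ k)).sum = 1 := by
  induction k with
  | zero => simp
  | succ k ih =>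
    rw [pow_succ', Nat.digits_base_mul (by norm_num) (by positivity)]
    simpa using ih

lemma digits_sum_two_pow_sub_one (k : ℕ) : (Nat.digits 2 (2 ^ k - 1)).sum = k := by
  induction k with
  | zero => simp
  | succ k ih =>
    have h1 : 2 ^ (k + 1) - 1 = 1 + 2 * (2 ^ k - 1) := by
      have := Nat.one_le_two_pow (n := k)
      rw [pow_succ]
      omega
    rw [h1, Nat.digits_add 2 (by norm_num) 1 _ (by norm_num) (Or.inl one_ne_zero)]
    simp [ih, add_comm]

lemma digits_sum_sum_two_pow_le {ι : Type*} (s : Finset ι) (p : ι → ℕ) :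
    (Nat.digits 2 (∑ i ∈ s, 2 ^ p i)).sum ≤ s.card := by
  classical
  induction s using Finset.induction_on with
  | empty => simp
  | insert i s hi ih =>
    rw [Finset.sum_insert hi, Finset.card_insert_of_notMem hi]
    have := digits_sum_add_le (2 ^ p i) (∑ i ∈ s, 2 ^ p i)
    rw [digits_sum_two_pow] at this
    omega

/-- This is the instability relation: the top square on a class of degree `d` is `Sq^d f = f ^ 2`.
-/
lemma comp_sqSum_mon (b : Fin h →₀ ℕ) :
    homogeneousComponent (2 * b.degree) (sqSum h (mon b)) = mon b ^ 2 := by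
  have htop : ∀ b : Fin h →₀ ℕ, (totalSq h (mon b)).natDegree ≤ b.degree ∧
      (totalSq h (mon b)).coeff b.degree = mon b ^ 2 := by
    have hmul : ∀ a b : Fin h →₀ ℕ,
        ((totalSq h (mon a)).natDegree ≤ a.degree ∧
          (totalSq h (mon a)).coeff a.degree = mon a ^ 2) →
        ((totalSq h (mon b)).natDegree ≤ b.degree ∧
          (totalSq h (mon b)).coeff b.degree = mon b ^ 2) →
        ((totalSq h (mon (a + b))).natDegree ≤ (a + b).degree ∧
          (totalSq h (mon (a + b))).coeff (a + b).degree = mon (a + b) ^ 2) := by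
      intro a b ha hb
      rw [mon_add, map_mul, map_add]
      exact ⟨Polynomial.natDegree_mul_le_of_le ha.1 hb.1, by
        rw [Polynomial.coeff_mul_add_eq_of_natDegree_le ha.1 hb.1, ha.2, hb.2, mul_pow]⟩
    have hzero : (totalSq h (mon 0)).natDegree ≤ (0 : Fin h →₀ ℕ).degree ∧
        (totalSq h (mon 0)).coeff (0 : Fin h →₀ ℕ).degree = mon 0 ^ 2 := by
      simp [mon_zero]
    intro b
    induction b using Finsupp.induction_linear with
    | zero => exact hzero
    | add a b ha hb => exact hmul a b ha hb
    | single j n =>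
      induction n with
      | zero => simpa using hzero
      | succ n ih =>
        rw [Finsupp.single_add]
        refine hmul _ _ ih ?_
        rw [mon_single, pow_one, Finsupp.degree_single]
        have : totalSq h (X j : P h) =
            Polynomial.C ((X j : P h) ^ 2) * Polynomial.X + Polynomial.C (X j : P h) := by
          simp [totalSq, add_comm]
        rw [this]
        refine ⟨Polynomial.natDegree_linear_le, ?_⟩
        rw [Polynomial.coeff_add, Polynomial.coeff_C_mul, Polynomial.coeff_C,
          Polynomial.coeff_X]
        simp
  rw [comp_sqSum, Finset.sum_eq_single b.degree]
  · rw [comp_mon, if_pos (by omega), Sq_apply, (htop b).2]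
  · intro k hk hkb
    rw [Finset.mem_range] at hk
    rw [comp_mon, if_neg (by omega), map_zero]
  · intro hb
    exact absurd (Finset.mem_range.2 (by omega)) hb

/-- If `2m + r` is the degree of a monomial with `r` odd exponents and `m + r` is not a sum of `r`
powers of two, then the monomial is hit. -/
lemma mon_mem_hit_of_forall_ne (a : Fin h →₀ ℕ)
    (ha : ∀ p : oddVars a → ℕ,
      ∑ j, 2 ^ p j ≠ (oddVars a).card + (halfExp a).degree) : mon a ∈ hit h := by
  set J := oddVars a with hJ
  set b := halfExp a with hb
  set n := J.card + 2 * b.degree with hn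
  have hu : (∏ j ∈ J, X j : P h) = mon (indicatorExp J) := (mon_indicatorExp J).symm
  -- `sqSum` telescopes on `∑ X j ^ 2 ^ i`, leaving `X j` and a power of degree `2 ^ n`, too large
  -- to reach degree `n`.
  set F : P h := (∏ j ∈ J, ∑ i ∈ Finset.range n, X j ^ 2 ^ i) * mon b with hF
  have hF0 : homogeneousComponent n F = 0 := by
    rw [hF, Finset.prod_sum, Finset.sum_mul, map_sum]
    refine Finset.sum_eq_zero fun p _ => ?_
    have hom : (∏ j ∈ J.attach, (X j.1 : P h) ^ 2 ^ p j.1 j.2) * mon b ∈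
        Pdeg h ((∑ j ∈ J.attach, 2 ^ p j.1 j.2) + b.degree) :=
      IsHomogeneous.mul (IsHomogeneous.prod _ _ _ fun j _ => isHomogeneous_X_pow _ _)
        (mon_mem_Pdeg b)
    rw [homogeneousComponent_of_mem hom, if_neg]
    -- As `n = r + 2m`, this term has degree `n` exactly when its powers of two add up to `r + m`,
    -- which `ha` forbids.
    have := ha fun j => p j.1 j.2
    rw [Finset.univ_eq_attach] at this
    omega
  have hsum : ∀ j : Fin h, sqSum h (∑ i ∈ Finset.range n, X j ^ 2 ^ i) = X j + X j ^ 2 ^ n := by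
    intro j
    have : sqSum h (X j : P h) = X j + X j ^ 2 := by simp [sqSum]
    rw [map_sum]
    simp only [map_pow, this]
    induction n with
    | zero => simp [CharTwo.add_self_eq_zero]
    | succ k ih =>
      rw [Finset.sum_range_succ, ih, add_pow_char_pow, ← pow_mul, ← pow_succ', add_assoc,
        ← add_assoc (X j ^ 2 ^ k) (X j ^ 2 ^ k), CharTwo.add_self_eq_zero, zero_add]
  have hSF : homogeneousComponent n (sqSum h F) = mon a := by
    rw [hF, map_mul, map_prod]
    simp only [hsum]
    rw [Finset.prod_add, Finset.sum_mul, map_sum, Finset.sum_eq_single J]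
    · rw [Finset.sdiff_self, Finset.prod_empty, mul_one, hu, hn, ← degree_indicatorExp J,
        comp_mon_mul, comp_sqSum_mon, mon_eq a, hu]
    · intro K hK hKJ
      obtain ⟨j, hj⟩ : (J \ K).Nonempty := by
        rw [Finset.sdiff_nonempty]
        exact fun hle => hKJ (Finset.Subset.antisymm (Finset.mem_powerset.1 hK) hle)
      have : (∏ i ∈ K, (X i : P h)) * (∏ i ∈ J \ K, X i ^ 2 ^ n) =
          mon (indicatorExp K + 2 ^ n • indicatorExp (J \ K)) := by
        have hpow : ∀ (k : ℕ) (c : Fin h →₀ ℕ), mon (k • c) = mon c ^ k := fun k c => by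
          simp [mon, monomial_pow]
        rw [mon_add, hpow, mon_indicatorExp, mon_indicatorExp, Finset.prod_pow]
      rw [this, comp_mon_mul_eq_zero]
      rw [map_add, map_nsmul, degree_indicatorExp, degree_indicatorExp, smul_eq_mul]
      have h1 : 0 < (J \ K).card := Finset.card_pos.2 ⟨j, hj⟩
      have h2 : n < 2 ^ n := Nat.lt_two_pow_self
      nlinarith
    · intro hJ'
      exact absurd (Finset.mem_powerset_self J) hJ'
  rw [← hSF]
  exact comp_sqSum_mem_hit hF0

/-! ### Arithmetic of the degrees `n_s` -/

lemma genericDegree_add_six (s : ℕ) : genericDegree s + 6 = 2 ^ (s + 4) := by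
  have := Nat.one_le_two_pow (n := s)
  rw [genericDegree, pow_add]
  omega

lemma genericDegree_succ (s : ℕ) : genericDegree (s + 1) = 2 * genericDegree s + 6 := by
  have h1 := genericDegree_add_six s
  have h2 := genericDegree_add_six (s + 1)
  have : 2 ^ (s + 1 + 4) = 2 * 2 ^ (s + 4) := by ring
  omega

/-- For `s ≥ 2`, every monomial of degree `n_s` with an even exponent is hit. -/
lemma mon_mem_hit_of_degree {s : ℕ} (hs : 2 ≤ s) {a : Fin 6 →₀ ℕ}
    (hd : a.degree = genericDegree s) (ha : oddVars a ≠ Finset.univ) : mon a ∈ hit 6 := by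
  refine mon_mem_hit_of_forall_ne a fun p hp => ?_
  have hcard : (oddVars a).card < 6 := by
    simpa using Finset.card_lt_card (Finset.ssubset_univ_iff.2 ha)
  have hdeg : (oddVars a).card + 2 * (halfExp a).degree + 6 = 2 ^ (s + 4) := by
    rw [← genericDegree_add_six, ← hd]
    conv_rhs => rw [exp_eq a]
    rw [map_add, map_nsmul, degree_indicatorExp, smul_eq_mul]
  have h2 : 2 ^ (s + 4) = 2 * 2 ^ (s + 3) := by ring
  have hsum := digits_sum_sum_two_pow_le Finset.univ p
  rw [hp, Finset.card_univ, Fintype.card_coe] at hsum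
  set r := (oddVars a).card
  set m := (halfExp a).degree
  -- The degree forces `r` to be even, and `r + m` falls short of `2 ^ (s + 3) - 1`, whose digit sum
  -- is `s + 3`, by `2 - r / 2`. Subadditivity gives `s + 3 ≤ r + (2 - r / 2) ≤ 4`, impossible for
  -- `s ≥ 2`; for `s = 1` the case `r = 4` survives.
  have h3 : r + m + ((6 - r) / 2 - 1) = 2 ^ (s + 3) - 1 := by omega
  have h4 := digits_sum_add_le (r + m) ((6 - r) / 2 - 1)
  rw [h3, digits_sum_two_pow_sub_one] at h4
  have h5 := Nat.digit_sum_le 2 ((6 - r) / 2 - 1)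
  omega

/-! ### Monomial bases -/

/-- A description of monomial bases without quotients. -/
def IsBasisModHit (h n : ℕ) (S : Set (P h)) : Prop :=
  (∀ t ∈ S, ∃ a : Fin h →₀ ℕ, t = mon a) ∧ (∀ t ∈ S, t ∈ Pdeg h n) ∧
  (∀ T : Finset (P h), (T : Set (P h)) ⊆ S → ∑ t ∈ T, t ∈ hit h → T = ∅) ∧
  ∀ f ∈ Pdeg h n, ∃ g ∈ Submodule.span (ZMod 2) S, f + g ∈ hit h

lemma IsBasisModHit.isMonomialBasis {n : ℕ} {S : Set (P h)} (hS : IsBasisModHit h n S) :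
    IsMonomialBasis h n S := by
  classical
  obtain ⟨hmon, hdeg, hli, hsp⟩ := hS
  refine ⟨hmon, hdeg, ?_, ?_⟩
  · rw [linearIndependent_iff']
    intro s c hc i hi
    have hsum : ((∑ i ∈ s, c i • (⟨i.1, hdeg i.1 i.2⟩ : Pdeg h n) : Pdeg h n) : P h) ∈ hit h := by
      refine (Submodule.Quotient.mk_eq_zero ((hit h).submoduleOf (Pdeg h n))).1 ?_
      rw [← hc, ← Submodule.mkQ_apply, map_sum]
      rfl
    have hT := hli ((s.filter fun i => c i = 1).map (Function.Embedding.subtype _)) (by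
      intro t ht
      obtain ⟨i, -, rfl⟩ := Finset.mem_map.1 ht
      exact i.2) (by
      rw [Finset.sum_map, Finset.sum_filter]
      convert hsum using 1
      rw [AddSubmonoidClass.coe_finsetSum]
      refine Finset.sum_congr rfl fun i _ => ?_
      obtain h0 | h1 : c i = 0 ∨ c i = 1 := by
        generalize c i = d
        revert d
        decide
      · simp [h0]
      · simp [h1])
    rw [Finset.map_eq_empty, Finset.filter_eq_empty_iff] at hT
    have := hT hi
    generalize c i = d at this
    revert d
    decide
  · rw [eq_top_iff]
    rintro x -
    obtain ⟨⟨f, hf⟩, rfl⟩ := Submodule.Quotient.mk_surjective _ x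
    obtain ⟨g, hg, hfg⟩ := hsp f hf
    have hspan : ∃ hg : g ∈ Pdeg h n, (cls ⟨g, hg⟩ : QP h n) ∈
        Submodule.span (ZMod 2) (Set.range fun t : ↥S => (cls ⟨t.1, hdeg t.1 t.2⟩ : QP h n)) := by
      clear hfg
      induction hg using Submodule.span_induction with
      | mem t ht => exact ⟨hdeg t ht, Submodule.subset_span ⟨⟨t, ht⟩, rfl⟩⟩
      | zero => exact ⟨Submodule.zero_mem _, Submodule.zero_mem _⟩
      | add x y _ _ hx hy =>
        obtain ⟨hx, hx'⟩ := hx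
        obtain ⟨hy, hy'⟩ := hy
        exact ⟨Submodule.add_mem _ hx hy, Submodule.add_mem _ hx' hy'⟩
      | smul c x _ hx =>
        obtain ⟨hx, hx'⟩ := hx
        exact ⟨Submodule.smul_mem _ c hx, Submodule.smul_mem _ c hx'⟩
    obtain ⟨hgd, hgs⟩ := hspan
    convert hgs using 1
    refine (Submodule.Quotient.eq _).2 ?_
    change f - g ∈ hit h
    rwa [CharTwo.sub_eq_add]

/-- Applying the down map to a hit sum of images gives independence. For spanning, `f` agrees modulo
hits with the up image of `downKameko h f`, and `hW` lets the up map transport the expansion of the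
latter. -/
lemma isBasisModHit_upKameko {m : ℕ} {S : Set (P h)}
    (hW : ∀ a : Fin h →₀ ℕ, a.degree = 2 * m + h → oddVars a ≠ Finset.univ → mon a ∈ hit h)
    (hS : IsBasisModHit h m S) : IsBasisModHit h (2 * m + h) (upKameko h '' S) := by
  classical
  obtain ⟨hmon, hdeg, hli, hsp⟩ := hS
  refine ⟨?_, ?_, ?_, ?_⟩
  · rintro _ ⟨t, ht, rfl⟩
    obtain ⟨a, rfl⟩ := hmon t ht
    exact ⟨_, upKameko_mon a⟩
  · rintro _ ⟨t, ht, rfl⟩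
    exact upKameko_mem_Pdeg (hdeg t ht)
  · intro T hT hh
    obtain ⟨T', hT', rfl⟩ := Finset.subset_set_image_iff.1 hT
    rw [Finset.sum_image upKameko_injective.injOn, ← upKameko_sum] at hh
    have hT'deg : ∑ t ∈ T', t ∈ Pdeg h m := Submodule.sum_mem _ fun t ht => hdeg t (hT' ht)
    have := downKameko_mem_hit (upKameko_mem_Pdeg hT'deg) hh
    rw [downKameko_upKameko] at this
    rw [hli T' hT' this, Finset.image_empty]
  · intro f hf
    obtain ⟨g, hg, hfg⟩ := hsp _ (downKameko_mem_Pdeg hf)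
    have hgdeg : g ∈ Pdeg h m := Submodule.span_le.2 hdeg hg
    refine ⟨upKameko h g, ?_, ?_⟩
    · clear hfg hgdeg
      induction hg using Submodule.span_induction with
      | mem t ht => exact Submodule.subset_span ⟨t, ht, rfl⟩
      | zero => rw [upKameko_zero]; exact Submodule.zero_mem _
      | add x y _ _ hx hy => rw [upKameko_add]; exact Submodule.add_mem _ hx hy
      | smul c x _ hx =>
        -- The up map is only additive; it commutes with scalars because they are `0` or `1`.
        obtain rfl | rfl : c = 0 ∨ c = 1 := by revert c; decide
        · rw [zero_smul, upKameko_zero]; exact Submodule.zero_mem _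
        · rwa [one_smul]
    · have h1 := upKameko_mem_hit hW (Submodule.add_mem _ (downKameko_mem_Pdeg hf) hgdeg) hfg
      have h2 : f + upKameko h (downKameko h f) ∈ hit h :=
        mem_hit_of_downKameko_eq_zero hW
          (Submodule.add_mem _ hf (upKameko_mem_Pdeg (downKameko_mem_Pdeg hf)))
          (by rw [map_add, downKameko_upKameko, add_self_eq_zero])
      have := Submodule.add_mem _ h2 h1
      rwa [upKameko_add, add_assoc, ← add_assoc (upKameko h (downKameko h f)),
        add_self_eq_zero, zero_add] at this

/-! ### Admissible monomials -/

/-- A key whose linear order is the order on monomials. -/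
def monKey (a : Fin h →₀ ℕ) : Lex (Lex (ℕ → ℕ) × Lex (Fin h → ℕ)) :=
  toLex (toLex (weight a), toLex (⇑a))

lemma monLT_iff (a b : Fin h →₀ ℕ) : MonLT a b ↔ monKey a < monKey b := by
  rw [monKey, monKey, Prod.Lex.toLex_lt_toLex, MonLT]
  simp only [toLex_inj]

lemma monKey_injective : Function.Injective (monKey : (Fin h →₀ ℕ) → _) := by
  intro a b hab
  have := congrArg Prod.snd (toLex_inj.1 hab)
  exact DFunLike.coe_injective (toLex_inj.1 this)

/-- The largest monomial in a nonempty hit sum would be inadmissible, the others serving as the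
`z_j`. Spanning is descent along the monomial order, which terminates because each degree has
finitely many monomials. -/
lemma isBasisModHit_admissibleMonomials (h n : ℕ) :
    IsBasisModHit h n (admissibleMonomials h n) := by
  classical
  refine ⟨?_, ?_, ?_, ?_⟩
  · rintro _ ⟨a, -, -, rfl⟩
    exact ⟨a, rfl⟩
  · rintro _ ⟨a, rfl, -, rfl⟩
    exact mon_mem_Pdeg a
  · intro T hT hh
    have hT' : ∃ U : Finset (Fin h →₀ ℕ), (∀ a ∈ U, a.degree = n ∧ ¬ Inadmissible n a) ∧
        T = U.image mon := by
      have : (T : Set (P h)) ⊆ mon '' {a : Fin h →₀ ℕ | a.degree = n ∧ ¬ Inadmissible n a} := by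
        intro t ht
        obtain ⟨a, h1, h2, rfl⟩ := hT ht
        exact ⟨a, ⟨h1, h2⟩, rfl⟩
      obtain ⟨U, hU, hUT⟩ := Finset.subset_set_image_iff.1 this
      exact ⟨U, fun a ha => hU ha, hUT.symm⟩
    obtain ⟨U, hU, rfl⟩ := hT'
    rw [Finset.sum_image mon_injective.injOn] at hh
    rcases U.eq_empty_or_nonempty with rfl | hne
    · rfl
    exfalso
    obtain ⟨a, haU, hmax⟩ := Finset.exists_max_image U monKey hne
    have hUdeg : ∑ a ∈ U, mon a ∈ Pdeg h n := Submodule.sum_mem _ fun a ha => by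
      rw [← (hU a ha).1]
      exact mon_mem_Pdeg a
    obtain ⟨f, hf, hgf⟩ := (mem_hit_iff hUdeg).1 hh
    -- Inadmissibility allows only `0 < m < n`; the term `m = n` drops out because positive squares
    -- kill constants.
    rw [comp_sqSum_of_comp_eq_zero hf] at hgf
    refine (hU a haU).2 ⟨U.erase a, fun m => homogeneousComponent (n - m) f, ?_, ?_, ?_⟩
    · intro z hz
      obtain ⟨hza, hzU⟩ := Finset.mem_erase.1 hz
      exact ⟨(hU z hzU).1, (monLT_iff z a).2
        (lt_of_le_of_ne (hmax z hzU) fun he => hza (monKey_injective he))⟩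
    · intro m _
      exact homogeneousComponent_mem _ _
    · rw [← hgf, ← Finset.add_sum_erase U mon haU, add_left_comm, add_self_eq_zero, add_zero]
  · have hmon : ∀ a : Fin h →₀ ℕ, a.degree = n →
        ∃ g ∈ Submodule.span (ZMod 2) (admissibleMonomials h n), mon a + g ∈ hit h := by
      have hfin : {a : Fin h →₀ ℕ | a.degree = n}.Finite := Finsupp.finite_of_degree_eq n
      by_contra! hbad
      obtain ⟨a₀, ha₀, hbad₀⟩ := hbad
      obtain ⟨a, ha, hmin⟩ := Finset.exists_min_image
        (hfin.toFinset.filter fun a => ∀ g ∈ Submodule.span (ZMod 2) (admissibleMonomials h n),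
          mon a + g ∉ hit h) monKey ⟨a₀, by simpa using ⟨ha₀, hbad₀⟩⟩
      simp only [Finset.mem_filter, Set.Finite.mem_toFinset, Set.mem_ofPred_eq] at ha hmin
      obtain ⟨had, hab⟩ := ha
      by_cases hadm : Inadmissible n a
      · obtain ⟨Z, f, hZ, -, heq⟩ := hadm
        have hz : ∀ z ∈ Z, ∃ g ∈ Submodule.span (ZMod 2) (admissibleMonomials h n),
            mon z + g ∈ hit h := by
          intro z hz
          by_contra! hzb
          exact absurd (hmin z ⟨(hZ z hz).1, hzb⟩) (not_le.2 ((monLT_iff z a).1 (hZ z hz).2))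
        choose! g hg hgh using hz
        refine hab (∑ z ∈ Z, g z) (Submodule.sum_mem _ hg) ?_
        rw [heq, add_right_comm, ← Finset.sum_add_distrib]
        exact Submodule.add_mem _ (Submodule.sum_mem _ hgh)
          (Submodule.sum_mem _ fun m hm => Sq_mem_hit (Finset.mem_Ioo.1 hm).1 _)
      · refine hab (mon a) (Submodule.subset_span ⟨a, had, hadm, rfl⟩) ?_
        rw [add_self_eq_zero]
        exact Submodule.zero_mem _
    intro f hf
    have : ∀ a ∈ f.support, a.degree = n := fun a ha =>
      (IsHomogeneous.degree_eq_sum_deg_support hf ha).symm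
    choose! g hg hgh using hmon
    refine ⟨∑ a ∈ f.support, g a, Submodule.sum_mem _ fun a ha => hg a (this a ha), ?_⟩
    nth_rw 1 [eq_sum_mon f]
    rw [← Finset.sum_add_distrib]
    exact Submodule.sum_mem _ fun a ha => hgh a (this a ha)

/-! ### Iterating the up Kameko map -/

lemma upKameko_iterate (k : ℕ) (u : P h) :
    (upKameko h)^[k] u = (∏ j, X j ^ (2 ^ k - 1)) * u ^ 2 ^ k := by
  induction k with
  | zero => simp
  | succ k ih =>
    have h1 : 2 ^ (k + 1) - 1 = 1 + (2 ^ k - 1) * 2 := by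
      have := Nat.one_le_two_pow (n := k)
      rw [pow_succ]
      omega
    rw [Function.iterate_succ_apply', ih, upKameko_eq, mul_pow, ← mul_assoc, ← Finset.prod_pow,
      ← Finset.prod_mul_distrib, ← pow_mul, ← pow_succ, h1]
    simp only [pow_add, pow_mul, pow_one]

lemma isBasisModHit_iterate (k : ℕ) :
    IsBasisModHit 6 (genericDegree (k + 1))
      ((upKameko 6)^[k] '' admissibleMonomials 6 (genericDegree 1)) := by
  induction k with
  | zero => simpa using isBasisModHit_admissibleMonomials 6 (genericDegree 1)
  | succ k ih =>
    -- The target degree is `n_{k+2}`, so the bound `2 ≤ s` of the degree argument already holds at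
    -- the first step, out of `n_1`.
    have := isBasisModHit_upKameko (fun a ha => mon_mem_hit_of_degree (s := k + 2) (by omega)
      (by rw [ha, genericDegree_succ (k + 1)])) ih
    rwa [← genericDegree_succ, ← Set.image_comp, ← Function.iterate_succ'] at this

end HitProblem

theorem mainTheorem7 (s : ℕ) (hs : 2 ≤ s) :
    (HitProblem.upKameko 6)^[s - 1] ''
        HitProblem.admissibleMonomials 6 (HitProblem.genericDegree 1) =
      {t : HitProblem.P 6 |
        ∃ u ∈ HitProblem.admissibleMonomials 6 (HitProblem.genericDegree 1),
          t = (∏ j : Fin 6, MvPolynomial.X j ^ (2 ^ (s - 1) - 1)) * u ^ 2 ^ (s - 1)} ∧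
    HitProblem.IsMonomialBasis 6 (HitProblem.genericDegree s)
      ((HitProblem.upKameko 6)^[s - 1] ''
        HitProblem.admissibleMonomials 6 (HitProblem.genericDegree 1)) := by
  constructor
  · ext t
    simp only [Set.mem_image, Set.mem_ofPred_eq, HitProblem.upKameko_iterate, eq_comm]
  · have := (HitProblem.isBasisModHit_iterate (s - 1)).isMonomialBasis
    rwa [Nat.sub_add_cancel (by omega)] at this
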